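/- Theorem 2.1. Let $n\ge 2$. An $n$-crossing is a crossing in a disk at which $n$ strands, lying at $n$ different heights, meet in one point, each strand bisecting the crossing: the $2n$ endpoints lie on the boundary circle and each strand joins two opposite endpoints. A split is a system of $n$ pairwise disjoint arcs in the disk joining these $2n$ endpoints in pairs (up to isotopy). The $n$-skein relation $R$ of the crossing is the formal combination of splits with coefficients in $\mathbb{Z}[A,A^{-1}]$ obtained by placing the strands one after the other, from the bottom one to the top one: each new strand is laid on top of every diagram obtained so far, meeting only the arcs that have one end on each side of it, and each of those exactly once; the resulting double crossings are resolved in all possible combinations of $A$-splits and $B$-splits, each $A$-split contributing a factor $A$ and each $B$-split a factor $A^{-1}$; then like terms are collected. (At a double crossing, the $A$-split joins the two regions swept out when the overstrand is turned counterclockwise onto the understrand, and the $B$-split joins the other two regions.) The width $w(R)$ is the difference between the highest and the lowest power of $A$ appearing in the coefficients of $R$. Then every $n$-skein relation $R$ satisfies $$w(R)\le\left\lfloor \frac{n^2}{2}\right\rfloor .$$ -/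

import Mathlib

/-!
Multi-crossings, their splits and their skein relations.

An `n`-crossing is drawn in a disk whose boundary circle carries `2 n` endpoints, numbered
`0, 1, …, 2 n - 1` clockwise. It has `n` strands; since each strand bisects the crossing, strand `i`
(`i : Fin n`) runs from endpoint `i` to endpoint `i + n`. The type of the crossing is given by
the heights of the strands, read clockwise: a permutation `h` of `Fin n`, where `h i` is the level
of strand `i`, counted from the top: level `0` is the top strand.
-/

open scoped LaurentPolynomial

namespace MultiCrossing

/-- A diagram of arcs in the disk, recorded by which endpoint is joined to which:
`D x = y` and `D y = x` if an arc joins `x ≠ y`, and `D x = x` if no arc ends at `x`. The diagrams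
built below never have crossing arcs, and once all `n` strands have been placed every endpoint
carries an arc: the result is a split, that is, `n` pairwise disjoint arcs which join
the `2 n` endpoints in pairs. -/
abbrev ArcDiagram (n : ℕ) : Type := Fin (2 * n) → Fin (2 * n)

/-- The diagram without arcs. -/
def ArcDiagram.empty (n : ℕ) : ArcDiagram n := id

/-- Draw an arc joining `p` and `q` (replacing whatever ended there). -/
def ArcDiagram.join {n : ℕ} (D : ArcDiagram n) (p q : Fin (2 * n)) : ArcDiagram n :=
  Function.update (Function.update D p q) q p

/-- The endpoint at which strand `i` begins. -/
def source {n : ℕ} (i : Fin n) : Fin (2 * n) := ⟨i, by omega⟩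

/-- The endpoint opposite to `source i`, at which strand `i` ends. -/
def target {n : ℕ} (i : Fin n) : Fin (2 * n) := ⟨i + n, by omega⟩

/-- The arcs of `D` which an overstrand placed along strand `i` intersects, in the order in which one
meets them when travelling along it from `source i` to `target i`. These are the arcs with one end on
either side of the overstrand, and each is met exactly once. An arc is listed as `(s, t)` where `s`
is its end to the left of the overstrand (the endpoints strictly between `source i` and
`target i`) and `t` its end to the right. As the arcs are disjoint, they are met in the order of
their left ends. -/
def crossedArcs {n : ℕ} (i : Fin n) (D : ArcDiagram n) : List (Fin (2 * n) × Fin (2 * n)) :=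
  ((List.finRange (2 * n)).filter fun s =>
    source i < s ∧ s < target i ∧ ¬ (source i ≤ D s ∧ D s ≤ target i)).map fun s => (s, D s)

/-- Formal combinations of diagrams with Laurent polynomials in `A` as coefficients; the variable
`A` is `LaurentPolynomial.T 1`. -/
abbrev DiagramModule (n : ℕ) : Type := ArcDiagram n →₀ ℤ[T;T⁻¹]

/-- Resolve the remaining double crossings of an overstrand in all ways. The overstrand has been
followed up to the arc which currently begins at the endpoint `p`; it still passes over the arcs
in the list and then ends at the endpoint `e`.

At a crossing with the arc `(s, t)` (`s` to the left, `t` to the right) the `A`-split joins the two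
regions swept out when the overstrand is turned counterclockwise onto the understrand. So
the incoming part of the overstrand turns left towards `s`, and the outgoing part is attached to `t`;
in the `B`-split it is the other way round. An `A`-split contributes a factor `A`, a `B`-split a
factor `A⁻¹`. -/
noncomputable def resolve {n : ℕ} (e : Fin (2 * n)) :
    List (Fin (2 * n) × Fin (2 * n)) → Fin (2 * n) → ArcDiagram n → DiagramModule n
  | [], p, D => Finsupp.single (D.join p e) 1
  | (s, t) :: arcs, p, D =>
      (LaurentPolynomial.T 1 : ℤ[T;T⁻¹]) • resolve e arcs t (D.join p s) +
        (LaurentPolynomial.T (-1) : ℤ[T;T⁻¹]) • resolve e arcs s (D.join p t)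

/-- Add strand `i` on top of the diagram `D` and resolve the resulting double crossings. -/
noncomputable def addStrand {n : ℕ} (i : Fin n) (D : ArcDiagram n) : DiagramModule n :=
  resolve (target i) (crossedArcs i D) (source i) D

/-- Add strand `i` on top of every diagram occurring in a formal combination, resolve, and collect
like terms. -/
noncomputable def addOverstrand {n : ℕ} (i : Fin n) (R : DiagramModule n) : DiagramModule n :=
  R.sum fun D c => c • addStrand i D

/-- The strands of the crossing with heights `h`, from the bottom one to the top one. -/
def bottomToTop {n : ℕ} (h : Equiv.Perm (Fin n)) : List (Fin n) :=
  (List.finRange n).reverse.map h.symm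

/-- The skein relation of the `n`-crossing with heights `h`, obtained by adding its strands one after
the other, from bottom to top. Its terms are the splits in its support, each with every monomial
`J * A ^ t`, `J ≠ 0`, of its coefficient. -/
noncomputable def skeinRelation {n : ℕ} (h : Equiv.Perm (Fin n)) : DiagramModule n :=
  (bottomToTop h).foldl (fun R i => addOverstrand i R)
    (Finsupp.single (ArcDiagram.empty n) 1)

/-- The powers of `A` which appear in a formal combination of diagrams. -/
noncomputable def powers {n : ℕ} (R : DiagramModule n) : Finset ℤ :=
  R.support.biUnion fun D => (R D).coeff.support

/-! A skein relation is not zero, so that it has a highest and a lowest power: the sum of the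
coefficients of all diagrams, taken modulo 3 at `A = -1`, is unchanged when a strand is added, since
`A + A⁻¹` becomes `1` there. -/

/-- Evaluation at `A = -1` modulo 3. -/
noncomputable def evalModThree : ℤ[T;T⁻¹] →+* ZMod 3 :=
  LaurentPolynomial.eval₂ (Int.castRingHom (ZMod 3)) (-1 : (ZMod 3)ˣ)

/-- The sum of all coefficients, evaluated at `A = -1` modulo 3. -/
noncomputable def totalModThree (n : ℕ) : DiagramModule n →+ ZMod 3 :=
  Finsupp.liftAddHom fun _ => evalModThree.toAddMonoidHom

theorem totalModThree_smul {n : ℕ} (c : ℤ[T;T⁻¹]) (R : DiagramModule n) :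
    totalModThree n (c • R) = evalModThree c * totalModThree n R := by
  induction R using Finsupp.induction_linear with
  | zero => simp
  | add f g hf hg => simp [smul_add, hf, hg, mul_add]
  | single D r =>
    rw [Finsupp.smul_single, smul_eq_mul]
    simp only [totalModThree, Finsupp.liftAddHom_apply_single]
    exact map_mul evalModThree c r

theorem totalModThree_resolve {n : ℕ} (e : Fin (2 * n))
    (arcs : List (Fin (2 * n) × Fin (2 * n))) (p : Fin (2 * n)) (D : ArcDiagram n) :
    totalModThree n (resolve e arcs p D) = 1 := by
  induction arcs generalizing p D with
  | nil => simp [resolve, totalModThree]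
  | cons a arcs ih =>
    obtain ⟨s, t⟩ := a
    rw [resolve, map_add, totalModThree_smul, totalModThree_smul, ih, ih]
    simp [evalModThree]
    decide

theorem totalModThree_addOverstrand {n : ℕ} (i : Fin n) (R : DiagramModule n) :
    totalModThree n (addOverstrand i R) = totalModThree n R := by
  rw [addOverstrand, Finsupp.sum, map_sum]
  simp only [totalModThree_smul, addStrand, totalModThree_resolve, mul_one]
  simp [totalModThree, Finsupp.sum]

theorem totalModThree_skeinRelation {n : ℕ} (h : Equiv.Perm (Fin n)) :
    totalModThree n (skeinRelation h) = 1 := by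
  have key : ∀ (l : List (Fin n)) (R : DiagramModule n),
      totalModThree n (l.foldl (fun R i => addOverstrand i R) R) = totalModThree n R := by
    intro l
    induction l with
    | nil => intro R; rfl
    | cons i l ih => intro R; rw [List.foldl_cons, ih, totalModThree_addOverstrand]
  rw [skeinRelation, key]
  simp [totalModThree]

theorem powers_nonempty {n : ℕ} (h : Equiv.Perm (Fin n)) : (powers (skeinRelation h)).Nonempty := by
  by_contra hne
  have hR : skeinRelation h = 0 := by
    ext D t
    by_contra hD
    refine hne ⟨t, ?_⟩
    rw [powers, Finset.mem_biUnion]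
    refine ⟨D, ?_, Finsupp.mem_support_iff.mpr hD⟩
    rw [Finsupp.mem_support_iff]
    intro h0
    exact hD (by rw [h0]; rfl)
  have h1 := totalModThree_skeinRelation h
  rw [hR, map_zero] at h1
  exact absurd h1 (by decide)

/-- The highest power of `A` appearing in the skein relation. -/
noncomputable def highestPower {n : ℕ} (h : Equiv.Perm (Fin n)) : ℤ :=
  (powers (skeinRelation h)).max' (powers_nonempty h)

/-- The lowest power of `A` appearing in the skein relation. -/
noncomputable def lowestPower {n : ℕ} (h : Equiv.Perm (Fin n)) : ℤ :=
  (powers (skeinRelation h)).min' (powers_nonempty h)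

/-- The width of the skein relation of the `n`-crossing with heights `h`. -/
noncomputable def width {n : ℕ} (h : Equiv.Perm (Fin n)) : ℤ :=
  highestPower h - lowestPower h

end MultiCrossing

/-! Each power of `A` in the relation comes from a state, a choice of split at every double
crossing; the power is the excess `k` of `A`-splits over `B`-splits. Two states of the same crossing
are compared while the strands are added from the bottom up. A missing strand `h` is weighted by
`sepCount (side h)`, twice the number of arcs across `h`, summed over both diagrams.
`Reaches.sub_add_sum_le` bounds `2 (k₁ - k₂)` plus the weights of any set `H` of missing strands by
`(|l| + |H|)²`, where `l` lists the strands already placed. With every strand placed and `H` empty,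
this is twice the width against `n²`.

In the induction let `g` be the newest strand, contributing `m₁` and `m₂`. Its weight before
placement is twice its number of double crossings in both diagrams, hence at least `2 (m₁ - m₂)`. So
if `g` raises no weight in `H`, the hypothesis for `H ∪ {g}` suffices. If it raises the weight of
some `h₀`, then in both diagrams the splits are forced at all arcs joining opposite sectors between
`g` and `h₀` (`Pending.sepCount_le_of_resolves`). Counting arc ends by sectors (`sepCount_add_le`)
then bounds `2 (m₁ - m₂)` plus the old weight of `h₀` by `4 |l|`. Each weight rises by at most `4`,
so the hypothesis for `H \ {h₀}` suffices, as `(a - 1)² + 4 a = (a + 1)²` with `a = |l| + |H|`. -/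

namespace MultiCrossing

/-! ### States behind the terms of a skein relation. -/

/-- `Resolves e arcs p D k D'`: some choice of splits at the double crossings with `arcs` turns `D`
into `D'`, with `k` more `A`-splits than `B`-splits. -/
inductive Resolves {n : ℕ} (e : Fin (2 * n)) :
    List (Fin (2 * n) × Fin (2 * n)) → Fin (2 * n) → ArcDiagram n → ℤ → ArcDiagram n → Prop
  | done (p : Fin (2 * n)) (D : ArcDiagram n) : Resolves e [] p D 0 (D.join p e)
  | splitA {s t : Fin (2 * n)} {arcs : List (Fin (2 * n) × Fin (2 * n))} {p : Fin (2 * n)}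
      {D : ArcDiagram n} {k : ℤ} {D' : ArcDiagram n} :
      Resolves e arcs t (D.join p s) k D' → Resolves e ((s, t) :: arcs) p D (k + 1) D'
  | splitB {s t : Fin (2 * n)} {arcs : List (Fin (2 * n) × Fin (2 * n))} {p : Fin (2 * n)}
      {D : ArcDiagram n} {k : ℤ} {D' : ArcDiagram n} :
      Resolves e arcs s (D.join p t) k D' → Resolves e ((s, t) :: arcs) p D (k - 1) D'

theorem coeff_T_mul (m k : ℤ) (f : ℤ[T;T⁻¹]) :
    (LaurentPolynomial.T m * f).coeff k = f.coeff (k - m) := by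
  have h := AddMonoidAlgebra.coeff_single_mul_eq_mul_coeff (r := (1 : ℤ)) (m := m) (m₁ := k) (x := f)
    (k - m) (fun a _ => by constructor <;> intro h <;> omega)
  rw [one_mul] at h
  exact h

/-- Collecting like terms can cancel states but never create them, so a nonzero coefficient has a
state behind it. An upper bound on the width needs only this direction. -/
theorem Resolves.of_coeff_ne_zero {n : ℕ} {e : Fin (2 * n)} :
    ∀ {arcs : List (Fin (2 * n) × Fin (2 * n))} {p : Fin (2 * n)} {D D' : ArcDiagram n} {k : ℤ},
      (resolve e arcs p D D').coeff k ≠ 0 → Resolves e arcs p D k D'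
  | [], p, D, D', k, h => by
    rw [resolve, Finsupp.single_apply] at h
    split_ifs at h with hD
    · subst hD
      have hk : k = 0 := by
        by_contra hk
        refine h ?_
        rw [← LaurentPolynomial.T_zero]
        exact Finsupp.single_eq_of_ne hk
      subst hk
      exact .done p D
    · simp at h
  | (s, t) :: arcs, p, D, D', k, h => by
    rw [resolve, Finsupp.add_apply, Finsupp.smul_apply, Finsupp.smul_apply, smul_eq_mul,
      smul_eq_mul] at h
    have h' : (resolve e arcs t (D.join p s) D').coeff (k - 1) +
        (resolve e arcs s (D.join p t) D').coeff (k - -1) ≠ 0 := by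
      rw [← coeff_T_mul, ← coeff_T_mul]
      exact h
    by_cases h1 : (resolve e arcs t (D.join p s) D').coeff (k - 1) = 0
    · rw [h1, zero_add] at h'
      have := Resolves.splitB (Resolves.of_coeff_ne_zero h')
      simpa using this
    · have := Resolves.splitA (Resolves.of_coeff_ne_zero h1)
      simpa using this

/-- `Reaches l D k`: the diagram `D` arises from the empty one by adding the strands in `l`, the last
one first, with `k` more `A`-splits than `B`-splits. -/
inductive Reaches {n : ℕ} : List (Fin n) → ArcDiagram n → ℤ → Prop
  | empty : Reaches [] (ArcDiagram.empty n) 0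
  | add {l : List (Fin n)} {D D' : ArcDiagram n} {k m : ℤ} (i : Fin n) : Reaches l D k →
      Resolves (target i) (crossedArcs i D) (source i) D m D' → Reaches (i :: l) D' (k + m)

theorem exists_of_coeff_addOverstrand_ne_zero {n : ℕ} {i : Fin n} {R : DiagramModule n}
    {D' : ArcDiagram n} {k : ℤ} (h : (addOverstrand i R D').coeff k ≠ 0) :
    ∃ D m₁ m₂, (R D).coeff m₁ ≠ 0 ∧ (addStrand i D D').coeff m₂ ≠ 0 ∧ m₁ + m₂ = k := by
  rw [addOverstrand, Finsupp.sum, Finsupp.finsetSum_apply] at h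
  have h1 : ∃ D ∈ R.support, ((R D • addStrand i D) D').coeff k ≠ 0 := by
    by_contra hne
    push Not at hne
    refine h ?_
    have : ∀ s : Finset (ArcDiagram n), s ⊆ R.support →
        (∑ D ∈ s, (R D • addStrand i D) D').coeff k = 0 := by
      intro s
      induction s using Finset.cons_induction with
      | empty => intro _; simp
      | cons a s ha ih =>
        intro hs
        rw [Finset.sum_cons]
        have h1 := hne a (hs (Finset.mem_cons_self a s))
        have h2 := ih (fun x hx => hs (Finset.mem_cons_of_mem hx))
        have : ∀ f g : ℤ[T;T⁻¹], (f + g).coeff k = f.coeff k + g.coeff k := fun _ _ => rfl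
        rw [this, h1, h2, add_zero]
    exact this _ subset_rfl
  obtain ⟨D, -, hD⟩ := h1
  rw [Finsupp.smul_apply, smul_eq_mul] at hD
  have hk : k ∈ (R D * addStrand i D D').coeff.support := Finsupp.mem_support_iff.mpr hD
  have := AddMonoidAlgebra.support_coeff_mul_subset _ _ hk
  rw [Finset.mem_add] at this
  obtain ⟨m₁, h₁, m₂, h₂, hm⟩ := this
  exact ⟨D, m₁, m₂, Finsupp.mem_support_iff.mp h₁, Finsupp.mem_support_iff.mp h₂, hm⟩

theorem Reaches.of_coeff_foldl_ne_zero {n : ℕ} (l : List (Fin n)) :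
    ∀ {D : ArcDiagram n} {k : ℤ},
      (l.foldr addOverstrand (Finsupp.single (ArcDiagram.empty n) 1) D).coeff k ≠ 0 →
        Reaches l D k := by
  induction l with
  | nil =>
    intro D k h
    rw [List.foldr_nil, Finsupp.single_apply] at h
    split_ifs at h with hD
    · subst hD
      have hk : k = 0 := by
        by_contra hk
        refine h ?_
        rw [← LaurentPolynomial.T_zero]
        exact Finsupp.single_eq_of_ne hk
      subst hk
      exact .empty
    · simp at h
  | cons i l ih =>
    intro D k h
    rw [List.foldr_cons] at h
    obtain ⟨D₀, m₁, m₂, h₁, h₂, rfl⟩ := exists_of_coeff_addOverstrand_ne_zero h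
    exact .add i (ih h₁) (.of_coeff_ne_zero h₂)

theorem Reaches.of_mem_powers {n : ℕ} {h : Equiv.Perm (Fin n)} {k : ℤ}
    (hk : k ∈ powers (skeinRelation h)) :
    ∃ D, Reaches ((List.finRange n).map h.symm) D k := by
  rw [powers, Finset.mem_biUnion] at hk
  obtain ⟨D, -, hD⟩ := hk
  refine ⟨D, .of_coeff_foldl_ne_zero _ ?_⟩
  rw [Finsupp.mem_support_iff, skeinRelation, bottomToTop, List.map_reverse,
    List.foldl_reverse] at hD
  exact hD

/-! ### Arcs across a strand, and their change under a single split. -/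

/-- The number of endpoints which `D` joins to an endpoint on the other side of the set `X`; this is
twice the number of arcs with one end in `X`. -/
def sepCount {n : ℕ} (X : Fin (2 * n) → Bool) (D : ArcDiagram n) : ℤ :=
  ∑ x, if X x = X (D x) then 0 else 1

/-- Double crossings with arcs of which only the right end lies in `X`. -/
def rightCount {n : ℕ} (X : Fin (2 * n) → Bool) (arcs : List (Fin (2 * n) × Fin (2 * n))) : ℕ :=
  arcs.countP fun a => !X a.1 && X a.2

/-- Double crossings with arcs of which only the left end lies in `X`. -/
def leftCount {n : ℕ} (X : Fin (2 * n) → Bool) (arcs : List (Fin (2 * n) × Fin (2 * n))) : ℕ :=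
  arcs.countP fun a => X a.1 && !X a.2

/-- Remove the arc joining `w` and `u`, draw one joining `p` and `w`, and leave `u` free. -/
def ArcDiagram.turn {n : ℕ} (D : ArcDiagram n) (p w u : Fin (2 * n)) : ArcDiagram n :=
  Function.update (D.join p w) u u

theorem ArcDiagram.join_update_left {n : ℕ} (D : ArcDiagram n) (p q r : Fin (2 * n)) :
    ArcDiagram.join (Function.update D p r) p q = D.join p q := by
  simp [ArcDiagram.join]

theorem ArcDiagram.turn_apply {n : ℕ} (D : ArcDiagram n) (p w u x : Fin (2 * n)) :
    D.turn p w u x = if x = u then u else if x = w then p else if x = p then w else D x := by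
  simp only [ArcDiagram.turn, ArcDiagram.join, Function.update_apply]

theorem ArcDiagram.join_apply {n : ℕ} (D : ArcDiagram n) (p q x : Fin (2 * n)) :
    D.join p q x = if x = q then p else if x = p then q else D x := by
  simp only [ArcDiagram.join, Function.update_apply]

theorem sepCount_turn {n : ℕ} (X : Fin (2 * n) → Bool) {D : ArcDiagram n} {p w u : Fin (2 * n)}
    (hp : D p = p) (hw : D w = u) (hu : D u = w) (hwu : w ≠ u) :
    sepCount X (D.turn p w u) = sepCount X D - 2 * (if X w = X u then 0 else 1) +
      2 * (if X p = X w then 0 else 1) := by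
  have hpw : p ≠ w := by rintro rfl; exact hwu (hp.symm.trans hw)
  have hpu : p ≠ u := by rintro rfl; exact hwu (hu.symm.trans hp)
  have key : ∀ x, (if X x = X (D.turn p w u x) then (0 : ℤ) else 1) =
      (if X x = X (D x) then 0 else 1) + (if x = p then (if X p = X w then 0 else 1) else 0) +
      (if x = w then (if X p = X w then 0 else 1) - (if X w = X u then 0 else 1) else 0) -
      (if x = u then (if X w = X u then 0 else 1) else 0) := by
    intro x
    rw [ArcDiagram.turn_apply]
    by_cases h1 : x = u
    · subst h1
      simp [hu, Ne.symm hwu, Ne.symm hpu, eq_comm]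
    by_cases h2 : x = w
    · subst h2
      simp [hw, h1, Ne.symm hpw, eq_comm]
    by_cases h3 : x = p
    · subst h3
      simp [hp, h1, h2]
    · simp [h1, h2, h3]
  simp only [sepCount, key, Finset.sum_add_distrib, Finset.sum_sub_distrib, Finset.sum_ite_eq',
    Finset.mem_univ, if_true]
  ring

theorem sepCount_join {n : ℕ} (X : Fin (2 * n) → Bool) {D : ArcDiagram n} {p e : Fin (2 * n)}
    (hp : D p = p) (he : D e = e) :
    sepCount X (D.join p e) = sepCount X D + 2 * (if X p = X e then 0 else 1) := by
  have key : ∀ x, (if X x = X (D.join p e x) then (0 : ℤ) else 1) =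
      (if X x = X (D x) then 0 else 1) + (if x = p then (if X p = X e then 0 else 1) else 0) +
      (if x = e then (if X p = X e then 0 else 1) else 0) := by
    intro x
    rw [ArcDiagram.join_apply]
    by_cases h2 : x = e
    · subst h2
      by_cases h3 : x = p
      · subst h3
        simp [hp]
      · simp [he, h3, eq_comm]
    by_cases h3 : x = p
    · subst h3
      simp [hp, h2]
    · simp [h2, h3]
  simp only [sepCount, key, Finset.sum_add_distrib, Finset.sum_ite_eq', Finset.mem_univ, if_true]
  ring

/-! ### Disjointness of the arcs in the course of a resolution. -/

/-- The diagram `D` is a system of pairwise disjoint arcs whose ends are the points of `M`; the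
endpoints are listed in the order of `c` when going round the circle. -/
structure IsPlanar {n : ℕ} (c : Fin (2 * n) → ℕ) (M : Finset (Fin (2 * n))) (D : ArcDiagram n) :
    Prop where
  invol : ∀ x, D (D x) = x
  fixed : ∀ x, D x = x ↔ x ∉ M
  noncross : ∀ x y, ¬ (c x < c y ∧ c y < c (D x) ∧ c (D x) < c (D y))

/-- The situation in the course of `resolve`: the part of the overstrand up to the last double
crossing has become part of the arcs of `D`, the remaining part will run from the free
endpoint `p` to the free endpoint `e` and crosses `arcs`. The points which lie between `lo` and `hi`
are those beyond the last double crossing. -/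
structure Pending {n : ℕ} (c : Fin (2 * n) → ℕ) (M : Finset (Fin (2 * n))) (e p : Fin (2 * n))
    (lo hi : ℕ) (arcs : List (Fin (2 * n) × Fin (2 * n))) (D : ArcDiagram n) : Prop where
  planar : IsPlanar c ((M.erase p).erase e) D
  start_mem : p ∈ M
  end_mem : e ∈ M
  start_outer : c p ≤ lo ∨ hi ≤ c p
  lo_lt : lo < c e
  lt_hi : c e < hi
  inner : ∀ x, lo < c x → c x < hi → lo < c (D x) ∧ c (D x) < hi
  sees : ∀ x, c x < c (D x) → c x ≤ lo ∨ hi ≤ c x →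
    ((c x ≤ lo ∧ hi ≤ c (D x)) ↔ (c x < c p ∧ c p < c (D x)))
  mem_arcs : ∀ x y, (x, y) ∈ arcs ↔ lo < c x ∧ c x < c e ∧ c e < c y ∧ D x = y
  sorted : arcs.Pairwise fun a b => c a.1 < c b.1

/-- The conclusion says that `x` and `y` lie on the same side of the chord from `p` to `w`,
whichever of `p` and `w` comes first. Here both lie outside the interval from `lo` to `hi`, and the
hypothesis `h` keeps `p` visible from inside it. -/
theorem not_separated_of_outer {lo hi p w x y : ℕ} (hp : p ≤ lo ∨ hi ≤ p) (hw : lo < w) (hw' : w < hi)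
    (hxy : x < y) (hx : x ≤ lo ∨ hi ≤ x) (hy : y ≤ lo ∨ hi ≤ y) (hxp : x ≠ p) (hyp : y ≠ p)
    (h : (x ≤ lo ∧ hi ≤ y) ↔ (x < p ∧ p < y)) :
    ((p < x ∧ x < w) ↔ (p < y ∧ y < w)) ∧ ((w < x ∧ x < p) ↔ (w < y ∧ y < p)) := by
  rcases hp with hp | hp <;> rcases hx with hx | hx <;> rcases hy with hy | hy <;> omega

theorem not_separated_of_inner {lo hi s t p w x y : ℕ} (hp : p ≤ lo ∨ hi ≤ p) (hst : s < t)
    (hw : w = s ∨ w = t) (hxy : x < y)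
    (hx : lo < x) (hy : y < hi) (h : y < s ∨ (s < x ∧ y < t) ∨ t < x) :
    ((p < x ∧ x < w) ↔ (p < y ∧ y < w)) ∧ ((w < x ∧ x < p) ↔ (w < y ∧ y < p)) := by
  rcases hp with hp | hp <;> rcases hw with hw | hw <;> rcases h with h | h | h <;> omega

/-- Relative to the first arc met by the overstrand, from `s` to `t`, another arc lies before it,
beneath it or after it. The hypothesis `h3` excludes an arc enclosing it, which would have been met
earlier. -/
theorem noncross_levels {s t m x y : ℕ} (h1 : ¬ (x < s ∧ s < y ∧ y < t))
    (h2 : ¬ (s < x ∧ x < t ∧ t < y)) (h3 : x < m → m < y → s ≤ x) (hsm : s < m) (hmt : m < t)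
    (hxs : x ≠ s) (hxt : x ≠ t) (hys : y ≠ s) (hyt : y ≠ t) : y < s ∨ (s < x ∧ y < t) ∨ t < x := by
  rcases lt_or_gt_of_ne hxs with h | h <;> rcases lt_or_gt_of_ne hyt with h' | h' <;> omega

theorem noncross_of_not_separated {p w x y : ℕ} (h : x < y →
      ((p < x ∧ x < w) ↔ (p < y ∧ y < w)) ∧ ((w < x ∧ x < p) ↔ (w < y ∧ y < p))) :
    ¬ (p < x ∧ x < w ∧ w < y) ∧ ¬ (w < x ∧ x < p ∧ p < y) ∧
      ¬ (x < p ∧ p < y ∧ y < w) ∧ ¬ (x < w ∧ w < y ∧ y < p) := by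
  refine ⟨?_, ?_, ?_, ?_⟩ <;> rintro ⟨h1, h2, h3⟩ <;> have h := h (by omega)
  · have := h.1.1; omega
  · have := h.2.1; omega
  · have := h.1.2; omega
  · have := h.2.2; omega

/-- One double crossing, with `w` the end that the incoming part turns to and `u` the end where the
outgoing part starts. The new arc from `p` to `w` crosses nothing: `sees` deals with the arcs
outside the old interval, and `levels` with those inside. The interval shrinks to that between `s`
and `t`, and the new start `u` lies on its boundary. -/
theorem Pending.turn {n : ℕ} {c : Fin (2 * n) → ℕ} (hc : Function.Injective c)
    {M : Finset (Fin (2 * n))} {e p : Fin (2 * n)} {lo hi : ℕ} {s t w u : Fin (2 * n)}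
    {arcs : List (Fin (2 * n) × Fin (2 * n))} {D : ArcDiagram n}
    (h : Pending c M e p lo hi ((s, t) :: arcs) D) (hwu : (w = s ∧ u = t) ∨ (w = t ∧ u = s)) :
    Pending c M e u (c s) (c t) arcs (D.turn p w u) := by
  obtain ⟨hlos, hse, het, hst⟩ := (h.mem_arcs s t).1 List.mem_cons_self
  have invol := h.planar.invol
  have hts : D t = s := by rw [← hst, invol]
  have hthi : c t < hi := hst ▸ (h.inner s hlos (by have := h.lt_hi; omega)).2
  have hlo := h.lo_lt
  have hhi := h.lt_hi
  have hpo := h.start_outer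
  have hp : D p = p := (h.planar.fixed p).2 (by simp)
  have hfirst : ∀ x, lo < c x → c x < c e → c e < c (D x) → c s ≤ c x := by
    intro x h1 h2 h3
    have hx := (h.mem_arcs x (D x)).2 ⟨h1, h2, h3, rfl⟩
    rcases List.mem_cons.1 hx with hx | hx
    · exact ((congrArg (fun a => c a.1) hx).symm).le
    · exact (List.rel_of_pairwise_cons h.sorted hx).le
  have hw : lo < c w ∧ c w < hi ∧ c w ≠ c e ∧ D w = u ∧ D u = w := by
    rcases hwu with ⟨rfl, rfl⟩ | ⟨rfl, rfl⟩ <;> refine ⟨?_, ?_, ?_, ?_, ?_⟩ <;> omega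
  obtain ⟨hw1, hw2, hw3, hwu', huw'⟩ := hw
  have hcwu : (c w = c s ∧ c u = c t) ∨ (c w = c t ∧ c u = c s) := by
    rcases hwu with ⟨rfl, rfl⟩ | ⟨rfl, rfl⟩ <;> simp
  have ne_of : ∀ {x y}, c x ≠ c y → x ≠ y := fun hxy hxy' => hxy (hxy' ▸ rfl)
  have cne_of : ∀ {x y}, x ≠ y → c x ≠ c y := fun hxy hxy' => hxy (hc hxy')
  have hpw : p ≠ w := ne_of (by omega)
  have hpu : p ≠ u := ne_of (by omega)
  have hwune : w ≠ u := ne_of (by omega)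
  have hpe : p ≠ e := ne_of (by omega)
  have hue : u ≠ e := ne_of (by omega)
  have hwe : w ≠ e := ne_of (by omega)
  have Eu : D.turn p w u u = u := by simp [ArcDiagram.turn_apply]
  have Ew : D.turn p w u w = p := by simp [ArcDiagram.turn_apply, hwune]
  have Ep : D.turn p w u p = w := by simp [ArcDiagram.turn_apply, hpw, hpu]
  have Eo : ∀ x, x ≠ p → x ≠ w → x ≠ u → D.turn p w u x = D x := by
    intro x h1 h2 h3
    simp [ArcDiagram.turn_apply, h1, h2, h3]
  have Do : ∀ x, x ≠ p → x ≠ w → x ≠ u → D x ≠ p ∧ D x ≠ w ∧ D x ≠ u := by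
    intro x h1 h2 h3
    refine ⟨fun h4 => h1 ?_, fun h4 => h3 ?_, fun h4 => h2 ?_⟩
    · rw [← invol x, h4, hp]
    · rw [← invol x, h4, hwu']
    · rw [← invol x, h4, huw']
  have four : ∀ x, x = p ∨ x = w ∨ x = u ∨ (x ≠ p ∧ x ≠ w ∧ x ≠ u) := by
    intro x; tauto
  have mem_of_ne : ∀ {x}, D x ≠ x → x ∈ M := by
    intro x hx
    by_contra hxM
    exact hx ((h.planar.fixed x).2 (by simp [hxM]))
  have outer : ∀ x, c x ≤ lo ∨ hi ≤ c x → c (D x) ≤ lo ∨ hi ≤ c (D x) := by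
    intro x hx
    by_contra hcon
    have := h.inner (D x) (by omega) (by omega)
    rw [invol] at this
    omega
  have levels : ∀ x, x ≠ p → x ≠ w → x ≠ u → c x < c (D x) → lo < c x → c x < hi →
      c (D x) < hi ∧ (c (D x) < c s ∨ (c s < c x ∧ c (D x) < c t) ∨ c t < c x) := by
    intro x h1 h2 h3 hx h4 h5
    have i1 := h.planar.noncross x s
    have i2 := h.planar.noncross s x
    have i3 := hfirst x h4
    have i4 := h.inner x h4 h5
    obtain ⟨-, h6, h7⟩ := Do x h1 h2 h3
    rw [hst] at i1 i2
    refine ⟨i4.2, ?_⟩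
    rcases hcwu with ⟨hcw, hcu⟩ | ⟨hcw, hcu⟩
    · exact noncross_levels i1 i2 i3 hse het (hcw ▸ cne_of h2) (hcu ▸ cne_of h3)
        (hcw ▸ cne_of h6) (hcu ▸ cne_of h7)
    · exact noncross_levels i1 i2 i3 hse het (hcu ▸ cne_of h3) (hcw ▸ cne_of h2)
        (hcu ▸ cne_of h7) (hcw ▸ cne_of h6)
  have visible : ∀ x, x ≠ p → x ≠ w → x ≠ u →
    ¬ (c p < c x ∧ c x < c w ∧ c w < c (D x)) ∧ ¬ (c w < c x ∧ c x < c p ∧ c p < c (D x)) ∧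
      ¬ (c x < c p ∧ c p < c (D x) ∧ c (D x) < c w) ∧
      ¬ (c x < c w ∧ c w < c (D x) ∧ c (D x) < c p) := by
    intro x h1 h2 h3
    obtain ⟨h5, h6, h7⟩ := Do x h1 h2 h3
    refine noncross_of_not_separated fun hx => ?_
    by_cases h4 : c x ≤ lo ∨ hi ≤ c x
    · exact not_separated_of_outer hpo hw1 hw2 hx h4 (outer x h4) (cne_of h1) (cne_of h5)
        (h.sees x hx h4)
    · push Not at h4
      obtain ⟨i1, i2⟩ := levels x h1 h2 h3 hx h4.1 h4.2
      exact not_separated_of_inner hpo (hse.trans het) (hcwu.imp And.left And.left) hx h4.1 i1 i2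
  refine ⟨⟨?_, ?_, ?_⟩, ?_, h.end_mem, ?_, hse, het, ?_, ?_, ?_, h.sorted.of_cons⟩
  · intro x
    rcases four x with rfl | rfl | rfl | ⟨h1, h2, h3⟩
    · rw [Ep, Ew]
    · rw [Ew, Ep]
    · rw [Eu, Eu]
    · obtain ⟨h5, h6, h7⟩ := Do x h1 h2 h3
      rw [Eo x h1 h2 h3, Eo _ h5 h6 h7, invol]
  · intro x
    have hM := h.planar.fixed
    rcases four x with rfl | rfl | rfl | ⟨h1, h2, h3⟩
    · simp [Ep, hpw.symm, hpe, hpu, h.start_mem]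
    · simp [Ew, hpw, hwune, hwe, mem_of_ne (hwu'.trans_ne hwune.symm)]
    · simp [Eu]
    · rw [Eo x h1 h2 h3, hM]
      simp [h1, h3]
  · intro x y
    rcases four x with rfl | rfl | rfl | ⟨h1, h2, h3⟩ <;>
      rcases four y with rfl | rfl | rfl | ⟨k1, k2, k3⟩
    · omega
    · rw [Ew, Ep]; omega
    · rw [Eu, Ep]; omega
    · rw [Ep, Eo y k1 k2 k3]
      exact (visible y k1 k2 k3).1
    · rw [Ew, Ep]; omega
    · omega
    · rw [Ew, Eu]; omega
    · rw [Ew, Eo y k1 k2 k3]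
      exact (visible y k1 k2 k3).2.1
    · rw [Eu]; omega
    · rw [Eu]; omega
    · omega
    · rw [Eu]; omega
    · rw [Ep, Eo x h1 h2 h3]
      exact (visible x h1 h2 h3).2.2.1
    · rw [Ew, Eo x h1 h2 h3]
      exact (visible x h1 h2 h3).2.2.2
    · rw [Eu]; omega
    · rw [Eo x h1 h2 h3, Eo y k1 k2 k3]
      exact h.planar.noncross x y
  · exact mem_of_ne (huw'.trans_ne hwune)
  · omega
  · intro x hx1 hx2
    have h1 : x ≠ p := ne_of (by omega)
    have h2 : x ≠ w := ne_of (by omega)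
    have h3 : x ≠ u := ne_of (by omega)
    obtain ⟨h5, h6, h7⟩ := Do x h1 h2 h3
    have i3 := cne_of h6
    have i4 := cne_of h7
    rw [Eo x h1 h2 h3]
    have i1 := h.planar.noncross s x
    have i2 := h.planar.noncross (D x) s
    rw [hst] at i1 i2
    rw [invol] at i2
    have i5 : c s ≤ c (D x) := not_lt.1 fun i => i2 ⟨i, hx1, hx2⟩
    have i6 : c (D x) ≤ c t := not_lt.1 fun i => i1 ⟨hx1, hx2, i⟩
    clear i1 i2 visible levels outer
    rcases hcwu with hcwu | hcwu <;> omega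
  · intro x hx hxo
    rcases four x with rfl | rfl | rfl | ⟨h1, h2, h3⟩
    · rw [Ep] at hx ⊢
      clear visible levels outer
      rcases hpo with hpo | hpo <;> rcases hcwu with hcwu | hcwu <;> omega
    · rw [Ew] at hx ⊢
      clear visible levels outer
      rcases hpo with hpo | hpo <;> rcases hcwu with hcwu | hcwu <;> omega
    · rw [Eu] at hx
      exact absurd hx (lt_irrefl _)
    · rw [Eo x h1 h2 h3] at hx ⊢
      by_cases h4 : c x ≤ lo ∨ hi ≤ c x
      · have i1 := outer x h4
        rcases h4 with h4 | h4 <;> rcases i1 with i1 | i1 <;>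
          rcases hcwu with hcwu | hcwu <;> omega
      · obtain ⟨-, i1⟩ := levels x h1 h2 h3 hx (by omega) (by omega)
        rcases i1 with i1 | i1 | i1 <;> rcases hcwu with hcwu | hcwu <;> omega
  · intro x y
    constructor
    · intro hxy
      obtain ⟨i1, i2, i3, i4⟩ := (h.mem_arcs x y).1 (List.mem_cons_of_mem _ hxy)
      have i5 := List.rel_of_pairwise_cons h.sorted hxy
      have h1 : x ≠ p := ne_of (by omega)
      have h2 : x ≠ w := ne_of (by simp only at i5; omega)
      have h3 : x ≠ u := ne_of (by simp only at i5; omega)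
      exact ⟨i5, i2, i3, by rw [Eo x h1 h2 h3, i4]⟩
    · rintro ⟨i1, i2, i3, i4⟩
      have h1 : x ≠ p := ne_of (by omega)
      have h2 : x ≠ w := ne_of (by omega)
      have h3 : x ≠ u := ne_of (by omega)
      rw [Eo x h1 h2 h3] at i4
      rcases List.mem_cons.1 ((h.mem_arcs x y).2 ⟨by omega, i2, i3, i4⟩) with hxy | hxy
      · obtain ⟨rfl, -⟩ := Prod.ext_iff.1 hxy
        simp at i1
      · exact hxy

theorem Pending.join {n : ℕ} {c : Fin (2 * n) → ℕ} (hc : Function.Injective c)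
    {M : Finset (Fin (2 * n))} {e p : Fin (2 * n)} {lo hi : ℕ} {D : ArcDiagram n}
    (h : Pending c M e p lo hi [] D) : IsPlanar c M (D.join p e) := by
  have invol := h.planar.invol
  have hlo := h.lo_lt
  have hhi := h.lt_hi
  have hpo := h.start_outer
  have hM := h.planar.fixed
  have hp : D p = p := (hM p).2 (by simp)
  have he : D e = e := (hM e).2 (by simp)
  have ne_of : ∀ {x y}, c x ≠ c y → x ≠ y := fun hxy hxy' => hxy (hxy' ▸ rfl)
  have cne_of : ∀ {x y}, x ≠ y → c x ≠ c y := fun hxy hxy' => hxy (hc hxy')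
  have hpe : p ≠ e := ne_of (by omega)
  have Ee : D.join p e e = p := by simp [ArcDiagram.join_apply]
  have Ep : D.join p e p = e := by simp [ArcDiagram.join_apply, hpe]
  have Eo : ∀ x, x ≠ p → x ≠ e → D.join p e x = D x := by
    intro x h1 h2
    simp [ArcDiagram.join_apply, h1, h2]
  have Do : ∀ x, x ≠ p → x ≠ e → D x ≠ p ∧ D x ≠ e := by
    intro x h1 h2
    refine ⟨fun h4 => h1 ?_, fun h4 => h2 ?_⟩
    · rw [← invol x, h4, hp]
    · rw [← invol x, h4, he]
  have three : ∀ x, x = p ∨ x = e ∨ (x ≠ p ∧ x ≠ e) := by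
    intro x; tauto
  have visible : ∀ x, x ≠ p → x ≠ e →
    ¬ (c p < c x ∧ c x < c e ∧ c e < c (D x)) ∧ ¬ (c e < c x ∧ c x < c p ∧ c p < c (D x)) ∧
      ¬ (c x < c p ∧ c p < c (D x) ∧ c (D x) < c e) ∧
      ¬ (c x < c e ∧ c e < c (D x) ∧ c (D x) < c p) := by
    intro x h1 h2
    obtain ⟨h5, h6⟩ := Do x h1 h2
    refine noncross_of_not_separated fun hx => ?_
    by_cases h4 : c x ≤ lo ∨ hi ≤ c x
    · have i1 : c (D x) ≤ lo ∨ hi ≤ c (D x) := by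
        by_contra hcon
        have := h.inner (D x) (by omega) (by omega)
        rw [invol] at this
        omega
      exact not_separated_of_outer hpo hlo hhi hx h4 i1 (cne_of h1) (cne_of h5) (h.sees x hx h4)
    · push Not at h4
      have i1 := h.inner x h4.1 h4.2
      have i2 : ¬ (c x < c e ∧ c e < c (D x)) := fun hcon =>
        List.not_mem_nil ((h.mem_arcs x (D x)).2 ⟨h4.1, hcon.1, hcon.2, rfl⟩)
      have i3 := cne_of h2
      have i4 := cne_of h6
      rcases hpo with hpo | hpo <;> rcases lt_or_gt_of_ne i3 with i5 | i5 <;> omega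
  refine ⟨?_, ?_, ?_⟩
  · intro x
    rcases three x with rfl | rfl | ⟨h1, h2⟩
    · rw [Ep, Ee]
    · rw [Ee, Ep]
    · obtain ⟨h5, h6⟩ := Do x h1 h2
      rw [Eo x h1 h2, Eo _ h5 h6, invol]
  · intro x
    rcases three x with rfl | rfl | ⟨h1, h2⟩
    · simp [Ep, hpe.symm, h.start_mem]
    · simp [Ee, hpe, h.end_mem]
    · rw [Eo x h1 h2, hM]
      simp [h1, h2]
  · intro x y
    rcases three x with rfl | rfl | ⟨h1, h2⟩ <;>
      rcases three y with rfl | rfl | ⟨k1, k2⟩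
    · omega
    · rw [Ep, Ee]; omega
    · rw [Ep, Eo y k1 k2]
      exact (visible y k1 k2).1
    · rw [Ep, Ee]; omega
    · omega
    · rw [Ee, Eo y k1 k2]
      exact (visible y k1 k2).2.1
    · rw [Ep, Eo x h1 h2]
      exact (visible x h1 h2).2.2.1
    · rw [Ee, Eo x h1 h2]
      exact (visible x h1 h2).2.2.2
    · rw [Eo x h1 h2, Eo y k1 k2]
      exact h.planar.noncross x y

theorem Resolves.abs_le_length {n : ℕ} {e p : Fin (2 * n)}
    {arcs : List (Fin (2 * n) × Fin (2 * n))} {D D' : ArcDiagram n} {k : ℤ}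
    (h : Resolves e arcs p D k D') : |k| ≤ arcs.length := by
  induction h with
  | done => simp
  | splitA _ ih => rw [List.length_cons, abs_le] at *; push_cast; omega
  | splitB _ ih => rw [List.length_cons, abs_le] at *; push_cast; omega

/-- While `resolve` runs, the value at the current start `p` may still point along the arc just cut.
The honest diagram is therefore `Function.update D p p`; the next `join` overwrites that value. -/
theorem Pending.isPlanar_of_resolves {n : ℕ} {c : Fin (2 * n) → ℕ} (hc : Function.Injective c)
    {M : Finset (Fin (2 * n))} {e p : Fin (2 * n)} {arcs : List (Fin (2 * n) × Fin (2 * n))}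
    {D D' : ArcDiagram n} {k : ℤ} (h : Resolves e arcs p D k D') :
    ∀ {lo hi : ℕ}, Pending c M e p lo hi arcs (Function.update D p p) → IsPlanar c M D' := by
  induction h with
  | done p D =>
    intro lo hi hP
    have := hP.join hc
    rwa [ArcDiagram.join_update_left] at this
  | splitA _ ih =>
    intro lo hi hP
    have := hP.turn hc (.inl ⟨rfl, rfl⟩)
    rw [ArcDiagram.turn, ArcDiagram.join_update_left] at this
    exact ih this
  | splitB _ ih =>
    intro lo hi hP
    have := hP.turn hc (.inr ⟨rfl, rfl⟩)
    rw [ArcDiagram.turn, ArcDiagram.join_update_left] at this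
    exact ih this

/-! ### Effect of an overstrand on the arcs across another strand. -/

theorem Pending.ends {n : ℕ} {c : Fin (2 * n) → ℕ} {M : Finset (Fin (2 * n))} {e p : Fin (2 * n)}
    {lo hi : ℕ} {s t : Fin (2 * n)} {arcs : List (Fin (2 * n) × Fin (2 * n))} {D : ArcDiagram n}
    (h : Pending c M e p lo hi ((s, t) :: arcs) D) : D p = p ∧ D s = t ∧ D t = s ∧ s ≠ t := by
  obtain ⟨-, h1, h2, h3⟩ := (h.mem_arcs s t).1 List.mem_cons_self
  refine ⟨(h.planar.fixed p).2 (by simp), h3, by rw [← h3, h.planar.invol], ?_⟩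
  rintro rfl
  omega

/-- How the number of arcs which cross another strand changes when an overstrand is resolved: it
grows by one at most, and only if the splits are forced at the arcs which join opposite sectors. -/
theorem Pending.sepCount_le_of_resolves {n : ℕ} {c : Fin (2 * n) → ℕ} (hc : Function.Injective c)
    {M : Finset (Fin (2 * n))} {e p : Fin (2 * n)} {arcs : List (Fin (2 * n) × Fin (2 * n))}
    {D D' : ArcDiagram n} {k : ℤ} (h : Resolves e arcs p D k D') {X : Fin (2 * n) → Bool}
    (hXe : X e = true) :
    ∀ {lo hi : ℕ}, Pending c M e p lo hi arcs (Function.update D p p) →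
      (arcs.Pairwise fun a b => (X a.1 = true → X b.1 = true) ∧ (X a.2 = true → X b.2 = true)) →
      (X p = false → sepCount X D' ≤ sepCount X (Function.update D p p) - 2 ∨
        (sepCount X D' ≤ sepCount X (Function.update D p p) + 2 ∧
          2 * (rightCount X arcs : ℤ) ≤ arcs.length - k ∧
          2 * (leftCount X arcs : ℤ) ≤ arcs.length + k)) ∧
      (X p = true → (∀ a ∈ arcs, X a.1 = true ∨ X a.2 = true) →
        sepCount X D' ≤ sepCount X (Function.update D p p)) := by
  -- Ends in `X` persist along the list: after an arc with both ends in `X` no arc leaves `X`, and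
  -- after one with some end in `X` every arc has such an end.
  have counts : ∀ (s t : Fin (2 * n)) (arcs : List (Fin (2 * n) × Fin (2 * n))),
      (((s, t) :: arcs).Pairwise fun a b =>
        (X a.1 = true → X b.1 = true) ∧ (X a.2 = true → X b.2 = true)) →
      (X s = true → X t = true → rightCount X arcs = 0 ∧ leftCount X arcs = 0) ∧
      (X s = true ∨ X t = true → ∀ a ∈ arcs, X a.1 = true ∨ X a.2 = true) := by
    intro s t arcs hpw
    have h1 := fun a ha => List.rel_of_pairwise_cons (a' := a) hpw ha
    refine ⟨fun hs ht => ⟨?_, ?_⟩, fun hst a ha => hst.imp (h1 a ha).1 (h1 a ha).2⟩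
    · rw [rightCount, List.countP_eq_zero]
      intro a ha
      simp [(h1 a ha).1 hs]
    · rw [leftCount, List.countP_eq_zero]
      intro a ha
      simp [(h1 a ha).2 ht]
  induction h with
  | done p D =>
    intro lo hi hP _
    have h1 := sepCount_join X (p := p) (e := e) ((hP.planar.fixed p).2 (by simp))
      ((hP.planar.fixed e).2 (by simp))
    rw [ArcDiagram.join_update_left] at h1
    rw [h1, hXe]
    constructor <;> intro hp <;> simp [hp, rightCount, leftCount]
  | @splitA s t arcs p D k D' hR ih =>
    intro lo hi hP hpw
    have hP' := hP.turn hc (.inl ⟨rfl, rfl⟩)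
    obtain ⟨hp, hs, ht, hne⟩ := hP.ends
    have hsep := sepCount_turn X hp hs ht hne
    rw [ArcDiagram.turn, ArcDiagram.join_update_left] at hP' hsep
    obtain ⟨ih1, ih2⟩ := ih hP' hpw.of_cons
    obtain ⟨hc1, hc2⟩ := counts s t arcs hpw
    have hk := abs_le.1 hR.abs_le_length
    rw [hsep] at ih1 ih2
    rw [rightCount, leftCount, List.countP_cons, List.countP_cons, ← rightCount, ← leftCount,
      List.length_cons]
    refine ⟨fun hXp => ?_, fun hXp hall => ?_⟩
    · cases hXs : X s <;> cases hXt : X t <;> simp [hXp, hXs, hXt] at ih1 ih2 hc1 hc2 ⊢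
      · rcases ih1 with ih1 | ih1 <;> omega
      -- Only the right end is in `X`: the `A`-split destroys a separated arc, draws an unseparated
      -- one and continues inside `X`, where nothing more is gained. Avoiding this loss forces a
      -- `B`-split here.
      · have := ih2 hc2
        omega
      · rcases ih1 with ih1 | ih1 <;> omega
      · have := ih2 hc2
        omega
    · have := hall _ List.mem_cons_self
      cases hXs : X s <;> cases hXt : X t <;> simp [hXp, hXs, hXt] at this ih1 ih2 hc1 hc2 ⊢
      · have := ih2 hc2
        omega
      · rcases ih1 with ih1 | ih1 <;> omega
      · have := ih2 hc2
        omega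
  | @splitB s t arcs p D k D' hR ih =>
    intro lo hi hP hpw
    have hP' := hP.turn hc (.inr ⟨rfl, rfl⟩)
    obtain ⟨hp, hs, ht, hne⟩ := hP.ends
    have hsep := sepCount_turn X hp ht hs hne.symm
    rw [ArcDiagram.turn, ArcDiagram.join_update_left] at hP' hsep
    obtain ⟨ih1, ih2⟩ := ih hP' hpw.of_cons
    obtain ⟨hc1, hc2⟩ := counts s t arcs hpw
    have hk := abs_le.1 hR.abs_le_length
    rw [hsep] at ih1 ih2
    rw [rightCount, leftCount, List.countP_cons, List.countP_cons, ← rightCount, ← leftCount,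
      List.length_cons]
    refine ⟨fun hXp => ?_, fun hXp hall => ?_⟩
    · cases hXs : X s <;> cases hXt : X t <;> simp [hXp, hXs, hXt] at ih1 ih2 hc1 hc2 ⊢
      · rcases ih1 with ih1 | ih1 <;> omega
      · rcases ih1 with ih1 | ih1 <;> omega
      -- The mirror image: with only the left end in `X`, a `B`-split loses an arc, so an `A`-split
      -- is forced.
      · have := ih2 hc2
        omega
      · have := ih2 hc2
        omega
    · have := hall _ List.mem_cons_self
      cases hXs : X s <;> cases hXt : X t <;> simp [hXp, hXs, hXt] at this ih1 ih2 hc1 hc2 ⊢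
      · rcases ih1 with ih1 | ih1 <;> omega
      · have := ih2 hc2
        omega
      · have := ih2 hc2
        omega

/-! ### The circle seen from the new strand. -/

/-- The position of the endpoint `x` when going clockwise round the circle from `source g`. -/
def rot {n : ℕ} (g : Fin n) (x : Fin (2 * n)) : ℕ :=
  if g.val ≤ x.val then x.val - g.val else x.val + 2 * n - g.val

theorem rot_injective {n : ℕ} (g : Fin n) : Function.Injective (rot g) := by
  intro x y h
  have := x.isLt
  have := y.isLt
  have := g.isLt
  ext
  unfold rot at h
  split_ifs at h <;> omega

theorem rot_lt {n : ℕ} (g : Fin n) (x : Fin (2 * n)) : rot g x < 2 * n := by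
  have := x.isLt
  have := g.isLt
  unfold rot
  split_ifs <;> omega

theorem isPlanar_rot_iff {n : ℕ} (g : Fin n) {M : Finset (Fin (2 * n))} {D : ArcDiagram n} :
    IsPlanar (rot g) M D ↔ IsPlanar Fin.val M D := by
  constructor <;> rintro ⟨h1, h2, h3⟩ <;> refine ⟨h1, h2, fun x y => ?_⟩
  all_goals
    -- A crossing of two arcs is a cyclic pattern `x, y, D x, D y`; moving the base point turns it
    -- into one of its four cyclic shifts.
    have i1 := h3 x y
    have i2 := h3 y (D x)
    have i3 := h3 (D x) (D y)
    have i4 := h3 (D y) x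
    simp only [h1] at i2 i3 i4
    clear h3
    have := x.isLt
    have := y.isLt
    have := (D x).isLt
    have := (D y).isLt
    have := g.isLt
    unfold rot at *
    rintro ⟨j1, j2, j3⟩
    by_cases a1 : g.val ≤ x.val <;> by_cases a2 : g.val ≤ y.val <;>
      by_cases a3 : g.val ≤ (D x).val <;> by_cases a4 : g.val ≤ (D y).val <;>
      simp only [a1, a2, a3, a4, if_true, if_false] at i1 i2 i3 i4 j1 j2 j3 <;> omega

/-- The endpoints on one side of the strand `i`, those to its left. -/
def side {n : ℕ} (i : Fin n) (x : Fin (2 * n)) : Bool :=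
  decide (i.val ≤ x.val ∧ x.val < i.val + n)

theorem rot_source {n : ℕ} (g : Fin n) : rot g (source g) = 0 := by
  simp [rot, source]

theorem rot_target {n : ℕ} (g : Fin n) : rot g (target g) = n := by
  simp [rot, target]

theorem mem_crossedArcs {n : ℕ} {g : Fin n} {D : ArcDiagram n} {x y : Fin (2 * n)} :
    (x, y) ∈ crossedArcs g D ↔ 0 < rot g x ∧ rot g x < n ∧ n < rot g y ∧ D x = y := by
  have h1 : ∀ z : Fin (2 * n), (source g < z ∧ z < target g) ↔ (0 < rot g z ∧ rot g z < n) := by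
    intro z
    have := z.isLt
    have := g.isLt
    simp only [rot, source, target, Fin.lt_def]
    split_ifs <;> omega
  have h2 : ∀ z : Fin (2 * n), ¬ (source g ≤ z ∧ z ≤ target g) ↔ n < rot g z := by
    intro z
    have := z.isLt
    have := g.isLt
    simp only [rot, source, target, Fin.le_def]
    split_ifs <;> omega
  simp only [crossedArcs, List.mem_map, List.mem_filter, List.mem_finRange, true_and,
    Prod.mk.injEq, decide_eq_true_eq]
  rw [← h2, ← and_assoc (a := 0 < rot g x), ← h1]
  constructor
  · rintro ⟨z, ⟨i1, i2, i3⟩, rfl, rfl⟩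
    exact ⟨⟨i1, i2⟩, i3, rfl⟩
  · rintro ⟨⟨i1, i2⟩, i3, rfl⟩
    exact ⟨x, ⟨i1, i2, i3⟩, rfl, rfl⟩

theorem pairwise_crossedArcs {n : ℕ} (g : Fin n) (D : ArcDiagram n) :
    (crossedArcs g D).Pairwise fun a b => rot g a.1 < rot g b.1 := by
  rw [crossedArcs, List.pairwise_map]
  refine (List.Pairwise.filter _ (List.pairwise_lt_finRange _)).imp_of_mem ?_
  intro x y hx hy hxy
  simp only [List.mem_filter, List.mem_finRange, true_and, decide_eq_true_eq, source, target,
    Fin.lt_def] at hx hy hxy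
  have := x.isLt
  have := y.isLt
  simp only [rot]
  split_ifs <;> omega

/-- The initial situation: the interval from `0` to `2 * n` contains every endpoint except `source
g`, the start of the overstrand, so `sees` has no arcs to constrain. -/
theorem pending_crossedArcs {n : ℕ} {g : Fin n} {M : Finset (Fin (2 * n))} {D : ArcDiagram n}
    (h : IsPlanar (rot g) M D) (hs : source g ∉ M) (ht : target g ∉ M) :
    Pending (rot g) (insert (source g) (insert (target g) M)) (target g) (source g) 0 (2 * n)
      (crossedArcs g D) (Function.update D (source g) (source g)) := by
  have hDs : D (source g) = source g := (h.fixed _).2 hs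
  have hup : Function.update D (source g) (source g) = D := by
    rw [Function.update_eq_self_iff, hDs]
  have hn := g.pos
  have hst : source g ≠ target g := by
    intro heq
    have := congrArg Fin.val heq
    simp only [source, target] at this
    omega
  rw [hup]
  refine ⟨?_, by simp, by simp, by simp [rot_source], by rw [rot_target]; omega,
    by rw [rot_target]; omega, ?_, ?_, ?_, pairwise_crossedArcs g D⟩
  · rw [Finset.erase_insert (by simp [hs, hst]), Finset.erase_insert ht]
    exact h
  · intro x hx _
    refine ⟨Nat.pos_of_ne_zero fun h0 => ?_, rot_lt g _⟩
    rw [← rot_source g] at h0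
    have h1 := rot_injective g h0
    rw [← h.invol x, h1, hDs, rot_source] at hx
    exact lt_irrefl _ hx
  · intro x hx hxo
    have := rot_lt g x
    have h0 : rot g x = 0 := by omega
    rw [← rot_source g] at h0
    rw [rot_injective g h0, hDs] at hx
    exact absurd hx (lt_irrefl _)
  · intro x y
    rw [mem_crossedArcs, rot_target]

/-! ### The four sectors between two strands. -/

/-- One of the two sides of the strand `h`, the one which contains `target g`. -/
def sideOf {n : ℕ} (g h : Fin n) (x : Fin (2 * n)) : Bool :=
  xor (decide (h.val < g.val)) (side h x)

theorem sepCount_sideOf {n : ℕ} (g h : Fin n) (D : ArcDiagram n) :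
    sepCount (sideOf g h) D = sepCount (side h) D := by
  simp [sepCount, sideOf]

theorem sideOf_eq_true_iff {n : ℕ} {g h : Fin n} {x : Fin (2 * n)} : sideOf g h x = true ↔
    (h.val < g.val ∧ ¬ (h.val ≤ x.val ∧ x.val < h.val + n)) ∨
      (¬ h.val < g.val ∧ h.val ≤ x.val ∧ x.val < h.val + n) := by
  by_cases hlt : h.val < g.val <;> simp [sideOf, side, hlt, imp_iff_not_or]

theorem sideOf_source {n : ℕ} {g h : Fin n} (hgh : g ≠ h) : sideOf g h (source g) = false := by
  have hg := g.isLt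
  have hh := h.isLt
  have : g.val ≠ h.val := fun hv => hgh (Fin.ext hv)
  rw [← Bool.not_eq_true, sideOf_eq_true_iff]
  simp only [source]
  omega

theorem sideOf_target {n : ℕ} {g h : Fin n} (hgh : g ≠ h) : sideOf g h (target g) = true := by
  have hg := g.isLt
  have hh := h.isLt
  have : g.val ≠ h.val := fun hv => hgh (Fin.ext hv)
  rw [sideOf_eq_true_iff]
  simp only [target]
  omega

theorem sideOf_left_mono {n : ℕ} {g h : Fin n} {x y : Fin (2 * n)} (hxy : rot g x ≤ rot g y)
    (hy : rot g y < n) (hx : sideOf g h x = true) : sideOf g h y = true := by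
  have hg := g.isLt
  have hh := h.isLt
  have := x.isLt
  have := y.isLt
  rw [sideOf_eq_true_iff] at *
  unfold rot at hxy hy
  split_ifs at hxy hy <;> omega

theorem sideOf_right_mono {n : ℕ} {g h : Fin n} {x y : Fin (2 * n)} (hxy : rot g y ≤ rot g x)
    (hy : n < rot g y) (hx : sideOf g h x = true) : sideOf g h y = true := by
  have hg := g.isLt
  have hh := h.isLt
  have := x.isLt
  have := y.isLt
  rw [sideOf_eq_true_iff] at *
  unfold rot at hxy hy
  split_ifs at hxy hy <;> omega

/-- Disjoint arcs crossed later have right ends earlier in the clockwise order, so both ends advance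
towards `target g`. On each side of `g` the strand `h` is passed only once, into the side containing
`target g`. -/
theorem pairwise_sideOf {n : ℕ} {g : Fin n} (h : Fin n) {M : Finset (Fin (2 * n))}
    {D : ArcDiagram n} (hD : IsPlanar (rot g) M D) :
    (crossedArcs g D).Pairwise fun a b => (sideOf g h a.1 = true → sideOf g h b.1 = true) ∧
      (sideOf g h a.2 = true → sideOf g h b.2 = true) := by
  refine (pairwise_crossedArcs g D).imp_of_mem ?_
  rintro ⟨s, t⟩ ⟨s', t'⟩ ha hb hlt
  obtain ⟨-, h1, h2, rfl⟩ := mem_crossedArcs.1 ha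
  obtain ⟨-, h1', h2', rfl⟩ := mem_crossedArcs.1 hb
  have := hD.noncross s s'
  simp only at hlt ⊢
  exact ⟨sideOf_left_mono hlt.le h1', sideOf_right_mono (by omega) h2'⟩

/-- `side g` contains `source g`, which `crossedArcs` excludes; this is harmless because `g` is not
yet placed and both its endpoints are fixed by `D`. -/
theorem countP_crossedArcs {n : ℕ} {g : Fin n} {M : Finset (Fin (2 * n))} {D : ArcDiagram n}
    (hD : IsPlanar (rot g) M D) (hs : source g ∉ M) (ht : target g ∉ M)
    (q : Fin (2 * n) × Fin (2 * n) → Bool) :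
    ((crossedArcs g D).countP q : ℤ) =
      ∑ x, if side g x = true ∧ side g (D x) = false ∧ q (x, D x) = true then 1 else 0 := by
  have h1 : ∀ x, (source g < x ∧ x < target g ∧ ¬ (source g ≤ D x ∧ D x ≤ target g)) ↔
      (side g x = true ∧ side g (D x) = false) := by
    intro x
    have h2 : x = source g → D x = source g := by rintro rfl; exact (hD.fixed _).2 hs
    have h3 : D x = target g → x = target g := by
      intro hx
      rw [← hD.invol x, hx, (hD.fixed _).2 ht]
    simp only [Fin.ext_iff, source, target] at h2 h3
    simp only [side, source, target, Fin.lt_def, Fin.le_def, decide_eq_true_eq,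
      decide_eq_false_iff_not]
    omega
  rw [crossedArcs, List.countP_map, List.countP_filter, List.countP_eq_length_filter,
    Finset.sum_boole, Finset.card_def, Finset.filter_val, Fin.univ_def]
  simp only [Multiset.filter_coe, Multiset.coe_card]
  congr 3
  ext x
  simp only [← and_assoc (c := q (x, D x) = true), ← h1]
  simp [Bool.and_comm]

theorem sum_comp_involutive {α : Type*} [Fintype α] {D : α → α} (hD : ∀ x, D (D x) = x)
    (f : α → ℤ) : ∑ x, f (D x) = ∑ x, f x :=
  Equiv.sum_comp (Function.Involutive.toPerm D hD) f

theorem sepCount_side_eq_length {n : ℕ} {g : Fin n} {M : Finset (Fin (2 * n))} {D : ArcDiagram n}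
    (hD : IsPlanar (rot g) M D) (hs : source g ∉ M) (ht : target g ∉ M) :
    sepCount (side g) D = 2 * (crossedArcs g D).length := by
  have h := countP_crossedArcs hD hs ht fun _ => true
  rw [List.countP_true] at h
  simp only [and_true] at h
  have h' := sum_comp_involutive hD.invol fun x =>
    if side g x = true ∧ side g (D x) = false then (1 : ℤ) else 0
  rw [two_mul, h]
  nth_rw 1 [← h']
  rw [← Finset.sum_add_distrib, sepCount]
  refine Finset.sum_congr rfl fun x _ => ?_
  rw [hD.invol]
  cases side g x <;> cases side g (D x) <;> simp

/-- The number of arcs which cross two given strands is bounded by the number of arc ends in two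
opposite sectors between these strands. -/
theorem sepCount_add_le {n : ℕ} {S X : Fin (2 * n) → Bool} {M : Finset (Fin (2 * n))}
    {D : ArcDiagram n} (hinv : ∀ x, D (D x) = x) (hM : ∀ x, D x = x ↔ x ∉ M) (b : Bool) :
    sepCount S D + sepCount X D ≤ 2 * (∑ x, if x ∈ M ∧ xor (S x) (X x) = b then 1 else 0) +
      4 * ∑ x, if S x = true ∧ S (D x) = false ∧ X x = b ∧ X (D x) = !b then 1 else 0 := by
  have h1 := sum_comp_involutive hinv fun x =>
    if x ∈ M ∧ xor (S x) (X x) = b then (1 : ℤ) else 0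
  have h2 := sum_comp_involutive hinv fun x =>
    if S x = true ∧ S (D x) = false ∧ X x = b ∧ X (D x) = !b then (1 : ℤ) else 0
  -- The value of `xor (S x) (X x)` names a pair of opposite sectors. An arc across exactly one
  -- strand has one end in the chosen pair. An arc across both has two ends there or none, and in
  -- the latter case the last two terms count it.
  have key : ∀ x, (if S x = S (D x) then (0 : ℤ) else 1) + (if X x = X (D x) then 0 else 1) ≤
      (if x ∈ M ∧ xor (S x) (X x) = b then 1 else 0) +
      (if D x ∈ M ∧ xor (S (D x)) (X (D x)) = b then 1 else 0) +
      2 * (if S x = true ∧ S (D x) = false ∧ X x = b ∧ X (D x) = !b then 1 else 0) +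
      2 * (if S (D x) = true ∧ S (D (D x)) = false ∧ X (D x) = b ∧ X (D (D x)) = !b
        then 1 else 0) := by
    intro x
    rw [hinv]
    by_cases hx : x ∈ M
    · have hDx : D x ∈ M := by
        by_contra hDx
        have := (hM _).2 hDx
        rw [hinv] at this
        exact (hM x).1 this.symm hx
      cases S x <;> cases S (D x) <;> cases X x <;> cases X (D x) <;> cases b <;> simp [hx, hDx]
    · rw [(hM x).2 hx]
      simp only [hx, if_true, false_and, if_false, zero_add]
      positivity
  have := Finset.sum_le_sum fun x (_ : x ∈ Finset.univ) => key x
  simp only [Finset.sum_add_distrib, ← Finset.mul_sum] at this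
  rw [sepCount, sepCount]
  linarith

/-- How the number of arcs which cross the strand `h` changes when the strand `g` is added. -/
theorem sepCount_le_of_addStrand {n : ℕ} {g h : Fin n} (hgh : g ≠ h) {M : Finset (Fin (2 * n))}
    {D D' : ArcDiagram n} (hD : IsPlanar Fin.val M D) (hs : source g ∉ M) (ht : target g ∉ M) {k : ℤ}
    (hR : Resolves (target g) (crossedArcs g D) (source g) D k D') :
    sepCount (side h) D' ≤ sepCount (side h) D - 2 ∨
      (sepCount (side h) D' ≤ sepCount (side h) D + 2 ∧
        sepCount (side h) D + 2 * k ≤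
          2 * ∑ x, (if x ∈ M ∧ xor (side g x) (sideOf g h x) = false then 1 else 0) ∧
        sepCount (side h) D - 2 * k ≤
          2 * ∑ x, (if x ∈ M ∧ xor (side g x) (sideOf g h x) = true then 1 else 0)) := by
  rw [← isPlanar_rot_iff g] at hD
  have hP := pending_crossedArcs hD hs ht
  have h1 := (hP.sepCount_le_of_resolves (rot_injective g) hR (sideOf_target hgh)
    (pairwise_sideOf h hD)).1 (sideOf_source hgh)
  have hup : Function.update D (source g) (source g) = D := by
    rw [Function.update_eq_self_iff, (hD.fixed _).2 hs]
  rw [hup, sepCount_sideOf, sepCount_sideOf] at h1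
  have hlen := sepCount_side_eq_length hD hs ht
  have hr := countP_crossedArcs hD hs ht fun a => !sideOf g h a.1 && sideOf g h a.2
  have hl := countP_crossedArcs hD hs ht fun a => sideOf g h a.1 && !sideOf g h a.2
  have hr' := sepCount_add_le (S := side g) (X := sideOf g h) hD.invol hD.fixed false
  have hl' := sepCount_add_le (S := side g) (X := sideOf g h) hD.invol hD.fixed true
  rw [← rightCount] at hr
  rw [← leftCount] at hl
  simp only [Bool.and_eq_true, Bool.not_eq_true'] at hr hl
  simp only [Bool.not_false, Bool.not_true, sepCount_sideOf] at hr' hl'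
  rw [← hr] at hr'
  rw [← hl] at hl'
  rcases h1 with h1 | ⟨h1, h2, h3⟩
  · exact .inl h1
  -- `sepCount (side g) D` is `2 * length`, which cancels against the forced-split bounds `2 *
  -- rightCount ≤ length - k` and `2 * leftCount ≤ length + k`.
  · exact .inr ⟨h1, by linarith, by linarith⟩

/-! ### Comparison of two states by induction on the strands. -/

/-- The endpoints of the strands in `l`. -/
def endpoints {n : ℕ} : List (Fin n) → Finset (Fin (2 * n))
  | [] => ∅
  | i :: l => insert (source i) (insert (target i) (endpoints l))

theorem source_ne_target {n : ℕ} (i j : Fin n) : source i ≠ target j := by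
  intro h
  have hv := congrArg Fin.val h
  have := i.isLt
  simp only [source, target] at hv
  omega

theorem notMem_endpoints {n : ℕ} {l : List (Fin n)} {i : Fin n} (hi : i ∉ l) :
    source i ∉ endpoints l ∧ target i ∉ endpoints l := by
  induction l with
  | nil => simp [endpoints]
  | cons j l ih =>
    rw [List.mem_cons, not_or] at hi
    have h1 := hi.1
    have hss : source i ≠ source j := by
      simpa [source, Fin.ext_iff] using h1
    have htt : target i ≠ target j := by
      simpa [target, Fin.ext_iff] using h1
    simp [endpoints, source_ne_target, (source_ne_target _ _).symm, hss, htt, ih hi.2]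

theorem card_endpoints {n : ℕ} {l : List (Fin n)} (hl : l.Nodup) :
    (endpoints l).card = 2 * l.length := by
  induction l with
  | nil => simp [endpoints]
  | cons i l ih =>
    rw [List.nodup_cons] at hl
    obtain ⟨h1, h2⟩ := notMem_endpoints hl.1
    rw [endpoints, Finset.card_insert_of_notMem (by simp [source_ne_target, h1]),
      Finset.card_insert_of_notMem h2, ih hl.2, List.length_cons]
    ring

theorem Reaches.isPlanar {n : ℕ} {l : List (Fin n)} {D : ArcDiagram n} {k : ℤ}
    (h : Reaches l D k) (hl : l.Nodup) : IsPlanar Fin.val (endpoints l) D := by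
  induction h with
  | empty =>
    refine ⟨fun _ => rfl, fun x => by simp [endpoints, ArcDiagram.empty], fun x y => ?_⟩
    simp only [ArcDiagram.empty, id]
    omega
  | add i _ hR ih =>
    rw [List.nodup_cons] at hl
    obtain ⟨h1, h2⟩ := notMem_endpoints hl.1
    have hD := (isPlanar_rot_iff i).2 (ih hl.2)
    exact (isPlanar_rot_iff i).1
      (Pending.isPlanar_of_resolves (rot_injective i) hR (pending_crossedArcs hD h1 h2))

/-- The difference of the powers of two terms is the smaller, the more of their arcs are crossed by
the strands which are still missing. -/
theorem Reaches.sub_add_sum_le {n : ℕ} {l : List (Fin n)} {D₁ : ArcDiagram n} {k₁ : ℤ}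
    (h₁ : Reaches l D₁ k₁) : ∀ {D₂ : ArcDiagram n} {k₂ : ℤ}, Reaches l D₂ k₂ → l.Nodup →
      ∀ H : Finset (Fin n), (∀ h ∈ H, h ∉ l) →
        2 * (k₁ - k₂) + ∑ h ∈ H, (sepCount (side h) D₁ + sepCount (side h) D₂) ≤
          ((l.length : ℤ) + H.card) ^ 2 := by
  induction h₁ with
  | empty =>
    rintro _ _ ⟨⟩ - H -
    simp only [sepCount, ArcDiagram.empty, id]
    simp
  | @add l D₁ D₁' k₁ m₁ g hr₁ hR₁ ih =>
    intro D₂' k₂' h₂ hl H hH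
    cases h₂ with
    | @add _ D₂ _ k₂ m₂ _ hr₂ hR₂ =>
    rw [List.nodup_cons] at hl
    obtain ⟨hs, ht⟩ := notMem_endpoints hl.1
    have hD₁ := hr₁.isPlanar hl.2
    have hD₂ := hr₂.isPlanar hl.2
    have hgH : g ∉ H := fun hg => hH g hg List.mem_cons_self
    have hHl : ∀ h ∈ H, h ∉ l := fun h hh hhl => hH h hh (List.mem_cons_of_mem _ hhl)
    -- A loss in one diagram offsets the gain of at most `2` in the other. If there is no such loss,
    -- one pair of opposite sectors is used for `D₁` and the complementary pair for `D₂`, so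
    -- together they count each of the `2 * l.length` endpoints once.
    have hstep : ∀ h ∈ H,
        (sepCount (side h) D₁' + sepCount (side h) D₂' ≤
          sepCount (side h) D₁ + sepCount (side h) D₂) ∨
        (sepCount (side h) D₁' + sepCount (side h) D₂' ≤
          sepCount (side h) D₁ + sepCount (side h) D₂ + 4 ∧
          2 * (m₁ - m₂) + (sepCount (side h) D₁ + sepCount (side h) D₂) ≤ 4 * l.length) := by
      intro h hh
      have hgh : g ≠ h := fun heq => hgH (heq ▸ hh)
      have hcard : (∑ x, (if x ∈ endpoints l ∧ xor (side g x) (sideOf g h x) = false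
          then (1 : ℤ) else 0)) + ∑ x, (if x ∈ endpoints l ∧ xor (side g x) (sideOf g h x) = true
          then (1 : ℤ) else 0) = 2 * l.length := by
        have hc : ((endpoints l).card : ℤ) = ∑ x, if x ∈ endpoints l then 1 else 0 := by simp
        rw [card_endpoints hl.2] at hc
        push_cast at hc
        rw [hc, ← Finset.sum_add_distrib]
        refine Finset.sum_congr rfl fun x _ => ?_
        by_cases hx : x ∈ endpoints l <;> cases side g x <;> cases sideOf g h x <;> simp [hx]
      rcases sepCount_le_of_addStrand hgh hD₁ hs ht hR₁ with i | ⟨i, j, -⟩ <;>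
        rcases sepCount_le_of_addStrand hgh hD₂ hs ht hR₂ with i' | ⟨i', -, j'⟩
      · exact .inl (by linarith)
      · exact .inl (by linarith)
      · exact .inl (by linarith)
      · exact .inr ⟨by linarith, by linarith⟩
    rw [List.length_cons]
    push_cast
    by_cases hall : ∀ h ∈ H, sepCount (side h) D₁' + sepCount (side h) D₂' ≤
        sepCount (side h) D₁ + sepCount (side h) D₂
    -- `g` joins the missing strands: its weight is twice the number of crossings it makes in both
    -- diagrams, which pays for `2 * (m₁ - m₂)`.
    · have h1 := ih hr₂ hl.2 (insert g H) fun h hh => by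
        rcases Finset.mem_insert.1 hh with rfl | hh
        · exact hl.1
        · exact hHl h hh
      rw [Finset.sum_insert hgH, Finset.card_insert_of_notMem hgH] at h1
      have h2 := Finset.sum_le_sum hall
      have e₁ := sepCount_side_eq_length ((isPlanar_rot_iff g).2 hD₁) hs ht
      have e₂ := sepCount_side_eq_length ((isPlanar_rot_iff g).2 hD₂) hs ht
      have a₁ := (abs_le.1 hR₁.abs_le_length).2
      have a₂ := (abs_le.1 hR₂.abs_le_length).1
      push_cast at h1
      linarith
    · push Not at hall
      obtain ⟨h₀, hh₀, hlt⟩ := hall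
      -- Dropping `h₀` frees its old weight, which `h3` bounds together with `2 * (m₁ - m₂)`.
      have h1 := ih hr₂ hl.2 (H.erase h₀) fun h hh => hHl h (Finset.mem_of_mem_erase hh)
      have h2 : ∑ h ∈ H, (sepCount (side h) D₁' + sepCount (side h) D₂') ≤
          ∑ h ∈ H, ((sepCount (side h) D₁ + sepCount (side h) D₂) + 4) :=
        Finset.sum_le_sum fun h hh => by rcases hstep h hh with i | ⟨i, -⟩ <;> linarith
      rw [Finset.sum_add_distrib (g := fun _ => (4 : ℤ)), Finset.sum_const, nsmul_eq_mul,
        ← Finset.add_sum_erase H (fun h => sepCount (side h) D₁ + sepCount (side h) D₂) hh₀] at h2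
      have h3 : 2 * (m₁ - m₂) + (sepCount (side h₀) D₁ + sepCount (side h₀) D₂) ≤ 4 * l.length := by
        rcases hstep h₀ hh₀ with i | ⟨-, i⟩
        · linarith
        · exact i
      have h4 : ((H.erase h₀).card : ℤ) = H.card - 1 := by
        rw [← Finset.card_erase_add_one hh₀]
        push_cast
        ring
      rw [h4] at h1
      linarith

end MultiCrossing

theorem theorem2p1 (n : ℕ) (hn : 2 ≤ n) (h : Equiv.Perm (Fin n)) :
    MultiCrossing.width h ≤ ⌊((n : ℚ) ^ 2) / 2⌋ := by
  obtain ⟨D₁, h₁⟩ := MultiCrossing.Reaches.of_mem_powers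
    (Finset.max'_mem _ (MultiCrossing.powers_nonempty h))
  obtain ⟨D₂, h₂⟩ := MultiCrossing.Reaches.of_mem_powers
    (Finset.min'_mem _ (MultiCrossing.powers_nonempty h))
  have key := h₁.sub_add_sum_le h₂ ((List.nodup_finRange n).map h.symm.injective) ∅ (by simp)
  rw [← MultiCrossing.highestPower, ← MultiCrossing.lowestPower, ← MultiCrossing.width] at key
  simp only [Finset.sum_empty, add_zero, List.length_map, List.length_finRange, Finset.card_empty,
    Nat.cast_zero] at key
  -- The width is an integer, so the floor costs nothing beyond `2 * width ≤ n ^ 2`.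
  rw [Int.le_floor, le_div_iff₀ two_pos]
  have : ((2 * MultiCrossing.width h : ℤ) : ℚ) ≤ ((n : ℤ) ^ 2 : ℤ) := by exact_mod_cast key
  push_cast at this
  linarith
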